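/- Let $[T]$ be a finite universe of tokens. Queries $q=(q_1,\dots,q_{\mathrm{len}(q)})$ and documents $d=(d_1,\dots,d_{\mathrm{len}(d)})$ are nonempty finite sequences of tokens. Every token $t$ occurring in a query $q$ has a unit-norm embedding $E_q(t)\in\mathbb{R}^m$, and every position $j$ of a document $d$ has a unit-norm embedding $E_d(d_j)\in\mathbb{R}^m$ (embeddings may depend on the whole query or document). For a pair $(q,d)$ let $x_{(q,d)}\in\mathbb{R}^T$ be the vector with $x_{(q,d)}(t)=\max_{1\le j\le \mathrm{len}(d)} E_q(t)^\top E_d(d_j)$ if $t$ occurs in $q$, and $x_{(q,d)}(t)=0$ otherwise. The Weighted Chamfer score of $(q,d)$ under weights $w\in\mathbb{R}^T$ is $\langle w,x_{(q,d)}\rangle$. There is a universal constant $C>0$ such that the following holds for all $T$, $m$ and all such embeddings. Let $\mathfrak D$ be a probability distribution on query–document pairs, let $$A=\mathbb{E}_{(q,d)\sim\mathfrak D}\Big[\tfrac{1}{\mathrm{len}(q)}\,x_{(q,d)}x_{(q,d)}^\top\Big],$$ and suppose $\lambda_{\min}(A)>0$. Let $w_*\in\mathbb{R}^T$, $\delta\in(0,1)$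 and $$n\ \ge\ C\,\frac{1}{\lambda_{\min}(A)}\log\frac{T}{\delta}.$$ Draw $(q^{(1)},d^{(1)}),\dots,(q^{(n)},d^{(n)})$ i.i.d. from $\mathfrak D$, let $X\in\mathbb{R}^{n\times T}$ be the matrix with rows $x_{(q^{(k)},d^{(k)})}$, and let $s=Xw_*$ be the vector of observed Weighted Chamfer scores. Then, with probability at least $1-\delta$, the matrix $X^\top X$ is invertible and the algorithm that outputs $(X^\top X)^{-1}X^\top s$ recovers the hidden weights exactly: $(X^\top X)^{-1}X^\top s=w_*$. Moreover, on the same event, if no sampled query contains a repeated token, the weights are likewise recovered from the length-normalized scores $$\eta_k=\frac{1}{\mathrm{len}(q^{(k)})}\sum_{i=1}^{\mathrm{len}(q^{(k)})} (w_*)_{q^{(k)}_i}\,\max_{j} E_{q^{(k)}}(q^{(k)}_i)^\top E_{d^{(k)}}(d^{(k)}_j),$$ namely by the same algorithm run on $s_k=\mathrm{len}(q^{(k)})\,\eta_k$. -/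

import Mathlib

open scoped Matrix

noncomputable section

namespace Chamfer

/-- A query or a document: a nonempty finite sequence of tokens from the universe `Fin T`. -/
structure TokenSeq (T : ℕ) where
  tokens : List (Fin T)
  nonempty : tokens ≠ []

/-- The number of tokens. -/
def TokenSeq.len {T : ℕ} (q : TokenSeq T) : ℕ := q.tokens.length

/-- Token sequences form a countable set; every subset of it is an event. -/
instance (T : ℕ) : MeasurableSpace (TokenSeq T) := ⊤

instance (T : ℕ) : DiscreteMeasurableSpace (TokenSeq T) := ⟨fun _ => trivial⟩

instance (T : ℕ) : Countable (TokenSeq T) :=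
  Function.Injective.countable (f := TokenSeq.tokens) (by
    rintro ⟨a, _⟩ ⟨b, _⟩ h
    cases h
    rfl)

/-- A query encoder: `EQ q t` is the embedding of the token `t` in the query `q`
(it may depend on the whole query; only the values with `t ∈ q` matter). -/
abbrev QueryEncoder (T m : ℕ) := TokenSeq T → Fin T → EuclideanSpace ℝ (Fin m)

/-- A document encoder: `ED d j` is the embedding of the `j`-th token of the document `d`
(it may depend on the whole document). -/
abbrev DocEncoder (T m : ℕ) := (d : TokenSeq T) → Fin d.len → EuclideanSpace ℝ (Fin m)

/-- The embeddings of the tokens of queries are unit vectors. -/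
def QueryEncoder.UnitNorm {T m : ℕ} (EQ : QueryEncoder T m) : Prop :=
  ∀ q : TokenSeq T, ∀ t ∈ q.tokens, ‖EQ q t‖ = 1

/-- The embeddings of the tokens of documents are unit vectors. -/
def DocEncoder.UnitNorm {T m : ℕ} (ED : DocEncoder T m) : Prop :=
  ∀ (d : TokenSeq T) (j : Fin d.len), ‖ED d j‖ = 1

variable {T m n : ℕ}

/-- `max_j ⟨E_q(t), E_d(d_j)⟩`, the maximum being over the positions of the document `d`. -/
def maxSim (EQ : QueryEncoder T m) (ED : DocEncoder T m) (q d : TokenSeq T) (t : Fin T) : ℝ :=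
  ⨆ j : Fin d.len, inner ℝ (EQ q t) (ED d j)

/-- The vector `x_{(q,d)} ∈ ℝ^T`, for the pair `z = (q, d)`. -/
def feature (EQ : QueryEncoder T m) (ED : DocEncoder T m) (z : TokenSeq T × TokenSeq T) :
    Fin T → ℝ :=
  fun t => if t ∈ z.1.tokens then maxSim EQ ED z.1 z.2 t else 0

/-- The Weighted Chamfer score `⟨w, x_{(q,d)}⟩`. -/
def score (EQ : QueryEncoder T m) (ED : DocEncoder T m) (w : Fin T → ℝ)
    (z : TokenSeq T × TokenSeq T) : ℝ :=
  w ⬝ᵥ feature EQ ED z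

/-- The length-normalized Weighted Chamfer score
`(1 / len q) ∑_i w_{q_i} max_j ⟨E_q(q_i), E_d(d_j)⟩`, summed over the positions of the query. -/
def normalizedScore (EQ : QueryEncoder T m) (ED : DocEncoder T m) (w : Fin T → ℝ)
    (z : TokenSeq T × TokenSeq T) : ℝ :=
  (1 / (z.1.len : ℝ)) *
    ∑ i : Fin z.1.len, w (z.1.tokens.get i) * maxSim EQ ED z.1 z.2 (z.1.tokens.get i)

/-- `A = E_{(q,d) ∼ D} [(1 / len q) x xᵀ]`. -/
def populationMatrix (EQ : QueryEncoder T m) (ED : DocEncoder T m)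
    (D : MeasureTheory.Measure (TokenSeq T × TokenSeq T)) : Matrix (Fin T) (Fin T) ℝ :=
  Matrix.of fun s t => ∫ z, (1 / (z.1.len : ℝ)) * (feature EQ ED z s * feature EQ ED z t) ∂D

/-- The smallest eigenvalue of a real symmetric matrix. -/
def lambdaMin (A : Matrix (Fin T) (Fin T) ℝ) : ℝ := sInf (spectrum ℝ A)

/-- The data matrix `X ∈ ℝ^{n × T}`, whose rows are the vectors `x_{(q,d)}` of the samples. -/
def dataMatrix (EQ : QueryEncoder T m) (ED : DocEncoder T m)
    (z : Fin n → TokenSeq T × TokenSeq T) : Matrix (Fin n) (Fin T) ℝ :=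
  Matrix.of fun k => feature EQ ED (z k)

/-- The learning algorithm: from the observed pairs `z` and numbers `s` it returns
`(XᵀX)⁻¹ Xᵀ s`. It has access to nothing else (besides the known encoders). -/
def learnWeights (EQ : QueryEncoder T m) (ED : DocEncoder T m)
    (z : Fin n → TokenSeq T × TokenSeq T) (s : Fin n → ℝ) : Fin T → ℝ :=
  ((dataMatrix EQ ED z)ᵀ * dataMatrix EQ ED z)⁻¹ *ᵥ ((dataMatrix EQ ED z)ᵀ *ᵥ s)

end Chamfer

end

/-! No matrix concentration is needed: exact recovery only requires the sampled features to span
`ℝ^T`, and the expected codimension of their span is tracked sample by sample. Let `r = λ_min(A)`.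
Summing `eᵀAe` over an orthonormal basis of `Vᗮ` gives at least `r · codim V`; it also equals the
expectation of `‖P x‖² / len q`, with `P` the projection onto `Vᗮ`. This variable is at most 1
because `‖x‖² ≤ len q`, and vanishes when `x ∈ V`, so a sample escapes `V` with probability at least
`r · codim V` (`lambdaMin_mul_codim_le`). Hence the expected codimension after `n` samples is at
most `T(1 - r)^n` (`integral_codim_span_le`). By Markov this bounds the failure probability, and
`T(1 - r)^n ≤ T exp(-rn) ≤ δ`. -/

open MeasureTheory Module

namespace Chamfer

/-! ### Spans of independent samples -/

section Spanning

variable {E α : Type*} [AddCommGroup E] [Module ℝ E]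

/-- The codimension of a subspace, as a real number. -/
noncomputable def codim (V : Submodule ℝ E) : ℝ := finrank ℝ E - finrank ℝ V

lemma codim_le (V : Submodule ℝ E) : codim V ≤ finrank ℝ E :=
  sub_le_self _ (Nat.cast_nonneg _)

lemma codim_sup_span_singleton_of_mem {V : Submodule ℝ E} {v : E} (hv : v ∈ V) :
    codim (V ⊔ Submodule.span ℝ {v}) = codim V := by
  rw [sup_eq_left.2 ((Submodule.span_singleton_le_iff_mem _ _).2 hv)]

variable [FiniteDimensional ℝ E]

lemma codim_nonneg (V : Submodule ℝ E) : 0 ≤ codim V :=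
  sub_nonneg.2 (Nat.cast_le.2 V.finrank_le)

lemma one_le_codim {V : Submodule ℝ E} (hV : V ≠ ⊤) : 1 ≤ codim V := by
  have h : finrank ℝ V + 1 ≤ finrank ℝ E := Submodule.finrank_lt hV
  have h' : (finrank ℝ V : ℝ) + 1 ≤ finrank ℝ E := by exact_mod_cast h
  unfold codim
  linarith

lemma codim_sup_span_singleton_of_notMem {V : Submodule ℝ E} {v : E} (hv : v ∉ V) :
    codim (V ⊔ Submodule.span ℝ {v}) = codim V - 1 := by
  unfold codim
  rw [Submodule.finrank_sup_span_singleton hv]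
  push_cast
  ring

variable [MeasurableSpace α] [DiscreteMeasurableSpace α]
  (D : Measure α) [IsProbabilityMeasure D]

lemma integrable_codim {β : Type*} [MeasurableSpace β] [DiscreteMeasurableSpace β]
    (μ : Measure β) [IsFiniteMeasure μ] (V : β → Submodule ℝ E) :
    Integrable (fun b => codim (V b)) μ :=
  Integrable.of_bound (C := finrank ℝ E) (Measurable.of_discrete).aestronglyMeasurable
    (.of_forall fun b => by
      rw [Real.norm_of_nonneg (codim_nonneg _)]
      exact codim_le _)

lemma integral_codim_sup_span_singleton (x : α → E) (V : Submodule ℝ E) :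
    ∫ a, codim (V ⊔ Submodule.span ℝ {x a}) ∂D = codim V - D.real {a | x a ∉ V} := by
  have h : ∀ a, codim (V ⊔ Submodule.span ℝ {x a}) =
      codim V - ({a | x a ∉ V} : Set α).indicator 1 a := by
    intro a
    by_cases ha : x a ∈ V
    · rw [codim_sup_span_singleton_of_mem ha]
      simp [ha]
    · simp [codim_sup_span_singleton_of_notMem ha, ha]
  simp_rw [h]
  have hi : Integrable (({a | x a ∉ V} : Set α).indicator (1 : α → ℝ)) D :=
    (integrable_const (1 : ℝ)).indicator (MeasurableSet.of_discrete)
  rw [integral_sub (integrable_const _) hi, integral_indicator_one (MeasurableSet.of_discrete)]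
  simp

variable [Countable α]

/-- If every subspace `V` is missed with probability at least `r · codim V`, then each further
sample shrinks the expected codimension of the span of the samples by the factor `1 - r`. -/
lemma integral_codim_span_le (x : α → E) {r : ℝ} (hr : r ≤ 1)
    (hx : ∀ V : Submodule ℝ E, r * codim V ≤ D.real {a | x a ∉ V}) (n : ℕ) (V : Submodule ℝ E) :
    ∫ z, codim (V ⊔ Submodule.span ℝ (Set.range fun k => x (z k)))
      ∂(Measure.pi fun _ : Fin n => D) ≤ (1 - r) ^ n * codim V := by
  -- The first sample is absorbed into `V`, so the induction hypothesis must hold for every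
  -- subspace.
  induction n generalizing V with
  | zero => simp
  | succ n ih =>
    have hmp := (measurePreserving_piFinSuccAbove (fun _ : Fin (n + 1) => D) 0).symm
    rw [← hmp.integral_comp (MeasurableEquiv.measurableEmbedding _),
      integral_prod _ (integrable_codim _ _)]
    have hcons : ∀ (a : α) (z : Fin n → α),
        V ⊔ Submodule.span ℝ (Set.range fun k => x ((MeasurableEquiv.piFinSuccAbove
          (fun _ : Fin (n + 1) => α) 0).symm (a, z) k)) =
        (V ⊔ Submodule.span ℝ {x a}) ⊔ Submodule.span ℝ (Set.range fun k => x (z k)) := by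
      intro a z
      rw [sup_assoc, ← Submodule.span_union]
      congr 2
      ext v
      simp [Fin.exists_fin_succ, eq_comm]
    simp_rw [hcons]
    have hInt : Integrable (fun p : α × (Fin n → α) => codim ((V ⊔ Submodule.span ℝ {x p.1}) ⊔
        Submodule.span ℝ (Set.range fun k => x (p.2 k)))) (D.prod (Measure.pi fun _ => D)) :=
      integrable_codim _ _
    have hInt' : Integrable (fun a => (1 - r) ^ n * codim (V ⊔ Submodule.span ℝ {x a})) D :=
      (integrable_codim _ _).const_mul _
    refine (integral_mono hInt.integral_prod_left hInt' fun a =>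
      ih (V ⊔ Submodule.span ℝ {x a})).trans ?_
    calc ∫ a, (1 - r) ^ n * codim (V ⊔ Submodule.span ℝ {x a}) ∂D
        = (1 - r) ^ n * (codim V - D.real {a | x a ∉ V}) := by
          rw [integral_const_mul, integral_codim_sup_span_singleton]
      _ ≤ (1 - r) ^ n * (codim V - r * codim V) := by
          have := hx V
          have : 0 ≤ (1 - r) ^ n := pow_nonneg (sub_nonneg.2 hr) n
          gcongr
      _ = _ := by ring

/-- The probability that `n` independent samples fail to span. -/
lemma measureReal_span_ne_top_le (x : α → E) {r : ℝ} (hr : r ≤ 1)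
    (hx : ∀ V : Submodule ℝ E, r * codim V ≤ D.real {a | x a ∉ V}) (n : ℕ) :
    (Measure.pi fun _ : Fin n => D).real
      {z | Submodule.span ℝ (Set.range fun k => x (z k)) ≠ ⊤} ≤ finrank ℝ E * (1 - r) ^ n := by
  have h := integral_codim_span_le D x hr hx n ⊥
  simp only [bot_sup_eq] at h
  have hb : codim (⊥ : Submodule ℝ E) = finrank ℝ E := by simp [codim]
  rw [hb, mul_comm] at h
  refine le_trans ?_ h
  -- Markov: a proper subspace has codimension at least 1, so the codimension dominates the failure
  -- indicator.
  rw [← integral_indicator_one (MeasurableSet.of_discrete)]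
  refine integral_mono ((integrable_const (1 : ℝ)).indicator (MeasurableSet.of_discrete))
    (integrable_codim _ _) fun z => ?_
  by_cases hz : Submodule.span ℝ (Set.range fun k => x (z k)) = ⊤
  · simpa [hz] using codim_nonneg _
  · simpa [hz] using one_le_codim hz

end Spanning

/-! ### Chamfer features and the population matrix -/

section Features

variable {T m n : ℕ}

lemma TokenSeq.len_pos (q : TokenSeq T) : 0 < q.len :=
  List.length_pos_iff.2 q.nonempty

lemma abs_feature_le_one {EQ : QueryEncoder T m} {ED : DocEncoder T m} (hQ : EQ.UnitNorm)
    (hD : ED.UnitNorm) (z : TokenSeq T × TokenSeq T) (t : Fin T) : |feature EQ ED z t| ≤ 1 := by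
  unfold feature
  split_ifs with ht
  · have hin : ∀ j, |inner ℝ (EQ z.1 t) (ED z.2 j)| ≤ 1 := fun j =>
      (abs_real_inner_le_norm _ _).trans (by rw [hQ _ _ ht, hD, one_mul])
    have : Nonempty (Fin z.2.len) := ⟨⟨0, z.2.len_pos⟩⟩
    refine abs_le.2 ⟨?_, ciSup_le fun j => (abs_le.1 (hin j)).2⟩
    exact (abs_le.1 (hin ⟨0, z.2.len_pos⟩)).1.trans (le_ciSup
      (f := fun j => inner ℝ (EQ z.1 t) (ED z.2 j)) (Set.finite_range _).bddAbove _)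
  · simp

/-- The feature vector as a point of Euclidean space. -/
noncomputable def featureVec (EQ : QueryEncoder T m) (ED : DocEncoder T m)
    (z : TokenSeq T × TokenSeq T) :
    EuclideanSpace ℝ (Fin T) := WithLp.toLp 2 (feature EQ ED z)

/-- Only the distinct tokens of the query contribute, each at most 1. This is what the factor `1 /
len q` in `A` compensates. -/
lemma norm_featureVec_sq_le {EQ : QueryEncoder T m} {ED : DocEncoder T m} (hQ : EQ.UnitNorm)
    (hD : ED.UnitNorm) (z : TokenSeq T × TokenSeq T) : ‖featureVec EQ ED z‖ ^ 2 ≤ z.1.len := by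
  rw [EuclideanSpace.real_norm_sq_eq]
  calc ∑ t, featureVec EQ ED z t ^ 2 ≤ ∑ t, if t ∈ z.1.tokens.toFinset then (1 : ℝ) else 0 := by
        refine Finset.sum_le_sum fun t _ => ?_
        split_ifs with ht
        · exact (sq_le_one_iff_abs_le_one _).2 (abs_feature_le_one hQ hD z t)
        · have : t ∉ z.1.tokens := by simpa using ht
          simp [featureVec, feature, this]
    _ = (z.1.tokens.toFinset.card : ℝ) := by rw [Finset.sum_ite_mem, Finset.univ_inter]; simp
    _ ≤ z.1.len := by exact_mod_cast List.toFinset_card_le _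

lemma integrable_of_bounded {β : Type*} [MeasurableSpace β] [DiscreteMeasurableSpace β]
    (μ : Measure β) [IsFiniteMeasure μ] (f : β → ℝ) (C : ℝ) (hf : ∀ b, |f b| ≤ C) :
    Integrable f μ :=
  Integrable.of_bound (C := C) (Measurable.of_discrete).aestronglyMeasurable
    (.of_forall hf)

/-- Shifting by `lambdaMin A` leaves a nonnegative spectrum, hence a positive semidefinite matrix.
-/
lemma lambdaMin_mul_norm_sq_le {A : Matrix (Fin T) (Fin T) ℝ} (hA : A.IsHermitian)
    (v : EuclideanSpace ℝ (Fin T)) : lambdaMin A * ‖v‖ ^ 2 ≤ v.ofLp ⬝ᵥ A *ᵥ v.ofLp := by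
  have hps : (A - algebraMap ℝ _ (lambdaMin A)).PosSemidef := by
    refine Matrix.posSemidef_iff_isHermitian_and_spectrum_nonneg.2 ⟨hA.sub ?_, ?_⟩
    · rw [Matrix.algebraMap_eq_diagonal]
      exact Matrix.isHermitian_diagonal _
    · rw [← spectrum.sub_singleton_eq]
      rintro _ ⟨a, ha, b, rfl, rfl⟩
      exact sub_nonneg.2 (csInf_le A.finite_spectrum.bddBelow ha)
  have h := hps.dotProduct_mulVec_nonneg v.ofLp
  rw [Matrix.sub_mulVec, dotProduct_sub, Algebra.algebraMap_eq_smul_one, Matrix.smul_mulVec,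
    Matrix.one_mulVec, dotProduct_smul] at h
  have hn : v.ofLp ⬝ᵥ v.ofLp = ‖v‖ ^ 2 := by
    rw [EuclideanSpace.real_norm_sq_eq, dotProduct]
    simp [sq]
  simp only [star_trivial, smul_eq_mul, hn] at h
  linarith

lemma populationMatrix_isHermitian (EQ : QueryEncoder T m) (ED : DocEncoder T m)
    (D : Measure (TokenSeq T × TokenSeq T)) : (populationMatrix EQ ED D).IsHermitian := by
  ext s t
  simp [populationMatrix, mul_comm]

variable {EQ : QueryEncoder T m} {ED : DocEncoder T m}

lemma inner_featureVec (v : EuclideanSpace ℝ (Fin T)) (z : TokenSeq T × TokenSeq T) :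
    inner ℝ v (featureVec EQ ED z) = ∑ t, v t * feature EQ ED z t := by
  simp [PiLp.inner_apply, featureVec, mul_comm]

lemma inv_len_le_one (q : TokenSeq T) : 1 / (q.len : ℝ) ≤ 1 := by
  have : (1 : ℝ) ≤ q.len := by exact_mod_cast q.len_pos
  exact (div_le_one (by linarith)).2 this

/-- Bessel's inequality combined with `‖x‖² ≤ len q`. -/
lemma sum_inv_len_mul_sq_le (hQ : EQ.UnitNorm) (hD : ED.UnitNorm) (z : TokenSeq T × TokenSeq T)
    {ι : Type*} (s : Finset ι) {e : ι → EuclideanSpace ℝ (Fin T)} (he : Orthonormal ℝ e) :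
    ∑ i ∈ s, 1 / (z.1.len : ℝ) * inner ℝ (e i) (featureVec EQ ED z) ^ 2 ≤ 1 := by
  have hl : (0 : ℝ) < z.1.len := by exact_mod_cast z.1.len_pos
  have h := he.sum_inner_products_le (featureVec EQ ED z) (s := s)
  simp only [Real.norm_eq_abs, sq_abs] at h
  rw [← Finset.mul_sum, one_div, inv_mul_le_iff₀ hl, mul_one]
  exact h.trans (norm_featureVec_sq_le hQ hD z)

lemma dotProduct_populationMatrix_mulVec (hQ : EQ.UnitNorm) (hD : ED.UnitNorm)
    (D : Measure (TokenSeq T × TokenSeq T)) [IsFiniteMeasure D] (v : EuclideanSpace ℝ (Fin T)) :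
    v.ofLp ⬝ᵥ populationMatrix EQ ED D *ᵥ v.ofLp =
      ∫ z, 1 / (z.1.len : ℝ) * inner ℝ v (featureVec EQ ED z) ^ 2 ∂D := by
  have hInt : ∀ s t, Integrable (fun z : TokenSeq T × TokenSeq T =>
      1 / (z.1.len : ℝ) * (feature EQ ED z s * feature EQ ED z t)) D := by
    intro s t
    refine integrable_of_bounded D _ 1 fun z => ?_
    rw [abs_mul, abs_mul, abs_of_nonneg (by positivity)]
    exact mul_le_one₀ (inv_len_le_one _) (by positivity)
      (mul_le_one₀ (abs_feature_le_one hQ hD z s) (abs_nonneg _) (abs_feature_le_one hQ hD z t))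
  have hexp : ∀ z : TokenSeq T × TokenSeq T,
      1 / (z.1.len : ℝ) * inner ℝ v (featureVec EQ ED z) ^ 2 =
      ∑ s, ∑ t, v s * v t * (1 / (z.1.len : ℝ) * (feature EQ ED z s * feature EQ ED z t)) := by
    intro z
    rw [inner_featureVec, sq, Finset.sum_mul_sum, Finset.mul_sum]
    refine Finset.sum_congr rfl fun s _ => ?_
    rw [Finset.mul_sum]
    exact Finset.sum_congr rfl fun t _ => by ring
  simp_rw [hexp]
  rw [integral_finsetSum _ fun s _ => integrable_finsetSum _ fun t _ => (hInt s t).const_mul _]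
  simp only [dotProduct, Matrix.mulVec]
  refine Finset.sum_congr rfl fun s _ => ?_
  rw [integral_finsetSum _ fun t _ => (hInt s t).const_mul _, Finset.mul_sum]
  refine Finset.sum_congr rfl fun t _ => ?_
  rw [integral_const_mul, populationMatrix, Matrix.of_apply]
  ring

/-- The features miss a subspace with probability at least `λ_min(A)` times its codimension. -/
lemma lambdaMin_mul_codim_le (hQ : EQ.UnitNorm) (hD : ED.UnitNorm)
    (D : Measure (TokenSeq T × TokenSeq T)) [IsProbabilityMeasure D]
    (V : Submodule ℝ (EuclideanSpace ℝ (Fin T))) :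
    lambdaMin (populationMatrix EQ ED D) * codim V ≤ D.real {z | featureVec EQ ED z ∉ V} := by
  set e := stdOrthonormalBasis ℝ Vᗮ
  have he : Orthonormal ℝ fun i => (e i : EuclideanSpace ℝ (Fin T)) :=
    e.orthonormal.comp_linearIsometry Vᗮ.subtypeₗᵢ
  have hc : codim V = finrank ℝ Vᗮ := by
    have h : (finrank ℝ V : ℝ) + finrank ℝ Vᗮ = finrank ℝ (EuclideanSpace ℝ (Fin T)) := by
      exact_mod_cast V.finrank_add_finrank_orthogonal
    unfold codim
    linarith
  have hInt : ∀ i, Integrable (fun z : TokenSeq T × TokenSeq T =>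
      1 / (z.1.len : ℝ) * inner ℝ (e i : EuclideanSpace ℝ (Fin T)) (featureVec EQ ED z) ^ 2) D := by
    intro i
    refine integrable_of_bounded D _ 1 fun z => ?_
    rw [abs_of_nonneg (by positivity)]
    simpa using sum_inv_len_mul_sq_le hQ hD z {i} he
  calc lambdaMin (populationMatrix EQ ED D) * codim V
      = ∑ i, lambdaMin (populationMatrix EQ ED D) * ‖(e i : EuclideanSpace ℝ (Fin T))‖ ^ 2 := by
        simp_rw [he.1, hc]
        simp [mul_comm]
    _ ≤ ∑ i, ∫ z, 1 / (z.1.len : ℝ) *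
          inner ℝ (e i : EuclideanSpace ℝ (Fin T)) (featureVec EQ ED z) ^ 2 ∂D :=
        Finset.sum_le_sum fun i _ => by
          rw [← dotProduct_populationMatrix_mulVec hQ hD]
          exact lambdaMin_mul_norm_sq_le (populationMatrix_isHermitian EQ ED D) _
    _ = ∫ z, ∑ i, 1 / (z.1.len : ℝ) *
          inner ℝ (e i : EuclideanSpace ℝ (Fin T)) (featureVec EQ ED z) ^ 2 ∂D :=
        (integral_finsetSum _ fun i _ => hInt i).symm
    _ ≤ ∫ z, ({z | featureVec EQ ED z ∉ V} : Set _).indicator 1 z ∂D := by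
        refine integral_mono (integrable_finsetSum _ fun i _ => hInt i)
          ((integrable_const (1 : ℝ)).indicator (MeasurableSet.of_discrete)) fun z => ?_
        by_cases hz : featureVec EQ ED z ∈ V
        · have h0 : ∀ i, inner ℝ (e i : EuclideanSpace ℝ (Fin T)) (featureVec EQ ED z) = 0 :=
            fun i => Submodule.inner_left_of_mem_orthogonal hz (e i).2
          simp [hz, h0]
        · simpa [hz] using sum_inv_len_mul_sq_le hQ hD z Finset.univ he
    _ = _ := integral_indicator_one (MeasurableSet.of_discrete)

/-- A kernel vector `v` of `XᵀX` satisfies `‖Xv‖² = 0`, so it is orthogonal to every row, hence to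
their span, hence to itself. -/
lemma isUnit_gram_of_span_eq_top {z : Fin n → TokenSeq T × TokenSeq T}
    (hz : Submodule.span ℝ (Set.range fun k => featureVec EQ ED (z k)) = ⊤) :
    IsUnit ((dataMatrix EQ ED z)ᵀ * dataMatrix EQ ED z) := by
  rw [← Matrix.mulVec_injective_iff_isUnit,
    ← Matrix.coe_mulVecLin, injective_iff_map_eq_zero]
  intro v hv
  rw [Matrix.mulVecLin_apply, ← Matrix.mulVec_mulVec] at hv
  have h0 : dataMatrix EQ ED z *ᵥ v = 0 := by
    rw [← dotProduct_self_eq_zero, Matrix.dotProduct_mulVec, ← Matrix.mulVec_transpose, hv,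
      zero_dotProduct]
  have hmem : ∀ y ∈ Submodule.span ℝ (Set.range fun k => featureVec EQ ED (z k)),
      inner ℝ (WithLp.toLp 2 v) y = 0 := by
    intro y hy
    induction hy using Submodule.span_induction with
    | mem y hy =>
      obtain ⟨k, rfl⟩ := hy
      rw [inner_featureVec]
      simpa [dataMatrix, Matrix.mulVec, dotProduct, mul_comm] using congrFun h0 k
    | zero => simp
    | add a b _ _ ha hb => rw [inner_add_right, ha, hb, add_zero]
    | smul c a _ ha => rw [inner_smul_right, ha, mul_zero]
  have hself := hmem (WithLp.toLp 2 v) (hz ▸ Submodule.mem_top)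
  simpa using inner_self_eq_zero.1 hself

lemma learnWeights_score {z : Fin n → TokenSeq T × TokenSeq T}
    (hz : IsUnit ((dataMatrix EQ ED z)ᵀ * dataMatrix EQ ED z)) (w : Fin T → ℝ) :
    learnWeights EQ ED z (fun k => score EQ ED w (z k)) = w := by
  have hs : (fun k => score EQ ED w (z k)) = dataMatrix EQ ED z *ᵥ w := by
    ext k
    exact dotProduct_comm _ _
  rw [learnWeights, hs, Matrix.mulVec_mulVec, Matrix.mulVec_mulVec, Matrix.mul_assoc,
    Matrix.nonsing_inv_mul _ ((Matrix.isUnit_iff_isUnit_det _).1 hz), Matrix.one_mulVec]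

/-- The feature vector counts a token once, the normalized score once per position; without
repetitions the two sums agree. -/
lemma len_mul_normalizedScore (w : Fin T → ℝ) {z : TokenSeq T × TokenSeq T}
    (hz : z.1.tokens.Nodup) : z.1.len * normalizedScore EQ ED w z = score EQ ED w z := by
  have hl : (z.1.len : ℝ) ≠ 0 := by exact_mod_cast z.1.len_pos.ne'
  rw [normalizedScore, ← mul_assoc, mul_one_div_cancel hl, one_mul]
  have hsum : score EQ ED w z =
      ∑ t ∈ z.1.tokens.toFinset, w t * maxSim EQ ED z.1 z.2 t := by
    rw [← Finset.univ_inter z.1.tokens.toFinset, ← Finset.sum_ite_mem]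
    simp [score, dotProduct, feature]
  rw [hsum, List.sum_toFinset _ hz]
  exact Fin.sum_univ_fun_getElem z.1.tokens fun t => w t * maxSim EQ ED z.1 z.2 t

/-- The escape bound at `V = ⊥` reads `λ_min · T ≤ 1`. It makes `1 - r` nonnegative, so that its
powers can be compared. -/
lemma lambdaMin_populationMatrix_le_one (hQ : EQ.UnitNorm) (hD : ED.UnitNorm) (hT : 0 < T)
    (D : Measure (TokenSeq T × TokenSeq T)) [IsProbabilityMeasure D] :
    lambdaMin (populationMatrix EQ ED D) ≤ 1 := by
  have h := (lambdaMin_mul_codim_le hQ hD D ⊥).trans measureReal_le_one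
  have hc : (1 : ℝ) ≤ codim (⊥ : Submodule ℝ (EuclideanSpace ℝ (Fin T))) := by
    simpa [codim] using Nat.succ_le_of_lt hT
  nlinarith

end Features

end Chamfer

theorem mainTheorem3 :
    ∃ C : ℝ, 0 < C ∧
      ∀ (T m : ℕ) (EQ : Chamfer.QueryEncoder T m) (ED : Chamfer.DocEncoder T m),
        EQ.UnitNorm → ED.UnitNorm →
      ∀ (D : MeasureTheory.Measure (Chamfer.TokenSeq T × Chamfer.TokenSeq T))
        [MeasureTheory.IsProbabilityMeasure D],
        0 < Chamfer.lambdaMin (Chamfer.populationMatrix EQ ED D) →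
      ∀ (w : Fin T → ℝ) (δ : ℝ), 0 < δ → δ < 1 →
      ∀ n : ℕ,
        C * (1 / Chamfer.lambdaMin (Chamfer.populationMatrix EQ ED D) * Real.log (T / δ)) ≤ n →
        1 - δ ≤ (MeasureTheory.Measure.pi fun _ : Fin n => D).real
          {z | IsUnit ((Chamfer.dataMatrix EQ ED z)ᵀ * Chamfer.dataMatrix EQ ED z) ∧
            Chamfer.learnWeights EQ ED z (fun k => Chamfer.score EQ ED w (z k)) = w ∧
            ((∀ k, (z k).1.tokens.Nodup) →
              Chamfer.learnWeights EQ ED z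
                (fun k => (z k).1.len * Chamfer.normalizedScore EQ ED w (z k)) = w)} := by
  refine ⟨1, one_pos, fun T m EQ ED hQ hD D _ hlam w δ hδ _ n hn => ?_⟩
  set r := Chamfer.lambdaMin (Chamfer.populationMatrix EQ ED D) with hr
  -- For `T = 0` the spectrum is empty and `sInf ∅ = 0`, against `hlam`.
  have hT : 0 < T := by
    rcases Nat.eq_zero_or_pos T with rfl | h
    · simp [hr, Chamfer.lambdaMin] at hlam
    · exact h
  have hT' : (0 : ℝ) < T := by exact_mod_cast hT
  have hr1 : r ≤ 1 := Chamfer.lambdaMin_populationMatrix_le_one hQ hD hT D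
  have hfail := Chamfer.measureReal_span_ne_top_le D (Chamfer.featureVec EQ ED) hr1
    (Chamfer.lambdaMin_mul_codim_le hQ hD D) n
  have hbound : (T : ℝ) * (1 - r) ^ n ≤ δ := by
    have hlog : Real.log (T / δ) ≤ n * r := by
      rwa [one_mul, one_div, inv_mul_le_iff₀ hlam, mul_comm r] at hn
    calc (T : ℝ) * (1 - r) ^ n ≤ T * Real.exp (-r) ^ n := by
          have := Real.one_sub_le_exp_neg r
          have : 0 ≤ 1 - r := sub_nonneg.2 hr1
          gcongr
      _ = T * Real.exp (-(n * r)) := by rw [← Real.exp_nat_mul, mul_neg]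
      _ ≤ T * Real.exp (-Real.log (T / δ)) := by gcongr
      _ = δ := by
          rw [Real.exp_neg, Real.exp_log (by positivity)]
          field_simp
  rw [finrank_euclideanSpace_fin] at hfail
  have hcompl := probReal_compl_eq_one_sub (μ := Measure.pi fun _ : Fin n => D)
    (s := {z | Submodule.span ℝ (Set.range fun k => Chamfer.featureVec EQ ED (z k)) ≠ ⊤})
    MeasurableSet.of_discrete
  refine (by linarith : 1 - δ ≤ _).trans (hcompl.symm.le.trans (measureReal_mono fun z hz => ?_))
  have hu := Chamfer.isUnit_gram_of_span_eq_top (not_not.1 hz)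
  refine ⟨hu, Chamfer.learnWeights_score hu w, fun hnd => ?_⟩
  simp_rw [Chamfer.len_mul_normalizedScore w (hnd _)]
  exact Chamfer.learnWeights_score hu w
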